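/- Let $n\ge 2$ and $m\ge 2$ be integers and let $\zeta\in\mathbb{C}$ be a primitive $(nm)$-th root of unity. Let $W_{\mathrm{aff}}$ be the affine Weyl group of type $\widetilde A_{n-1}$, with simple reflections $s_i$, $i\in\mathbb{Z}/n\mathbb{Z}$ (so $s_1,\dots,s_{n-1}$ generate $S_n$). It acts by $\mathbb{C}$-algebra automorphisms on the polynomial ring $R_m=\mathbb{C}[x_1,\dots,x_n]$ (indices of variables modulo $n$) via $$s_i(x_i)=\zeta x_{i+1},\qquad s_i(x_{i+1})=\zeta^{-1}x_i,\qquad s_i(x_j)=x_j\ \text{ for } j\notin\{i,i+1\}.$$ This action factors through the quotient $W_m=W_{\mathrm{aff}}/m\Lambda_{\mathrm{rt}}\cong G(m,m,n)$, where $\Lambda_{\mathrm{rt}}$ is the root lattice of $S_n$, i.e. the subgroup of translations, generated by the conjugates of $s_0t_{\mathrm{long}}$ with $t_{\mathrm{long}}=s_1s_2\cdots s_{n-1}\cdots s_2s_1$; thus $m\Lambda_{\mathrm{rt}}$ is generated by the conjugates of $(s_0t_{\mathrm{long}})^m$. Let $R_m^{W_m}$ be the subring of invariants, and grade $R_m$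 by $\deg x_i=1$. Choose any total order $i_1<i_2<\dots<i_n$ on the set $\{1,\dots,n\}$, and let $\mathbb{X}$ be the set of monomials $x_{i_1}^{a_1}\cdots x_{i_n}^{a_n}$, with integers $a_k\ge 0$, such that for every $1\le k\le n$: - if $a_i\neq 0$ for all $i<k$, then $a_k\le m(n-k)$; - if $a_i=0$ for some $i<k$, then $a_k\le m(n+1-k)-1$. Then $\mathbb{X}$ is a basis of $R_m$ as a (free) $R_m^{W_m}$-module, consisting of homogeneous elements. Moreover $\mathbb{X}$ is finite, and its graded count is $$\sum_{p\in\mathbb{X}}v^{\deg p}=(n)_v\,(m)_v\,(2m)_v\cdots((n-1)m)_v,\qquad (k)_v:=1+v+\dots+v^{k-1}.$$ -/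

import Mathlib

open MvPolynomial

noncomputable section

namespace ExoticReflection

/-- The algebra endomorphism of `ℂ[x_j : j ∈ ℤ/n]` with `x_a ↦ c x_b`, `x_b ↦ c⁻¹ x_a`, and
`x_j ↦ x_j` for all other `j`. -/
def swapHom {n : ℕ} (a b : ZMod n) (c : ℂ) :
    MvPolynomial (ZMod n) ℂ →ₐ[ℂ] MvPolynomial (ZMod n) ℂ :=
  aeval fun j =>
    if j = a then C c * X b else if j = b then C c⁻¹ * X a else X j

theorem swapHom_X {n : ℕ} (a b : ZMod n) (c : ℂ) (j : ZMod n) :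
    swapHom a b c (X j) =
      if j = a then C c * X b else if j = b then C c⁻¹ * X a else X j := by
  simp [swapHom]

theorem swapHom_C {n : ℕ} (a b : ZMod n) (c d : ℂ) :
    swapHom a b c (C d) = C d := by
  simp [swapHom, algebraMap_eq]

theorem swapHom_left {n : ℕ} (a b : ZMod n) (c : ℂ) :
    swapHom a b c (X a) = C c * X b := by
  simp [swapHom_X]

theorem swapHom_right {n : ℕ} {a b : ZMod n} (h : a ≠ b) (c : ℂ) :
    swapHom a b c (X b) = C c⁻¹ * X a := by
  simp [swapHom_X, h.symm]

theorem swapHom_other {n : ℕ} {a b j : ZMod n} (ha : j ≠ a) (hb : j ≠ b) (c : ℂ) :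
    swapHom a b c (X j) = X j := by
  simp [swapHom_X, ha, hb]

theorem C_mul_C_inv {n : ℕ} {c : ℂ} (hc : c ≠ 0) :
    (C c * C c⁻¹ : MvPolynomial (ZMod n) ℂ) = 1 := by
  rw [← C_mul, mul_inv_cancel₀ hc, C_1]

theorem swapHom_mul_self {n : ℕ} {a b : ZMod n} (h : a ≠ b) {c : ℂ} (hc : c ≠ 0) :
    swapHom a b c * swapHom a b c = 1 := by
  have hC := C_mul_C_inv (n := n) hc
  apply MvPolynomial.algHom_ext
  intro j
  rw [AlgHom.mul_apply, AlgHom.one_apply]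
  by_cases hja : j = a
  · subst hja
    rw [swapHom_left, map_mul, swapHom_C, swapHom_right h, ← mul_assoc, hC, one_mul]
  · by_cases hjb : j = b
    · subst hjb
      rw [swapHom_right h, map_mul, swapHom_C, swapHom_left, ← mul_assoc, mul_comm (C c⁻¹), hC,
        one_mul]
    · rw [swapHom_other hja hjb, swapHom_other hja hjb]

theorem swapHom_conj {n : ℕ} {a b d : ZMod n} (hab : a ≠ b) (hda : d ≠ a) (hdb : d ≠ b)
    {c e : ℂ} (he : e ≠ 0) :
    swapHom d a e * swapHom a b c * swapHom d a e = swapHom d b (c * e) := by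
  have hC := C_mul_C_inv (n := n) he
  apply MvPolynomial.algHom_ext
  intro j
  rw [AlgHom.mul_apply, AlgHom.mul_apply]
  by_cases hjd : j = d
  · subst hjd
    rw [swapHom_left, map_mul, swapHom_C, swapHom_left, map_mul, map_mul, swapHom_C, swapHom_C,
      swapHom_other hdb.symm hab.symm, swapHom_left, C_mul]
    ring
  · by_cases hja : j = a
    · subst hja
      rw [swapHom_right hda, map_mul, swapHom_C, swapHom_other hda hdb, map_mul, swapHom_C,
        swapHom_left, swapHom_other hjd hab, ← mul_assoc, mul_comm (C e⁻¹), hC, one_mul]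
    · by_cases hjb : j = b
      · subst hjb
        rw [swapHom_other hjd hja, swapHom_right hab, map_mul, swapHom_C, swapHom_right hda,
          swapHom_right hdb, mul_inv, C_mul]
        ring
      · rw [swapHom_other hjd hja, swapHom_other hja hjb, swapHom_other hjd hja,
          swapHom_other hjd hjb]

theorem swapHom_comm {n : ℕ} {a b d e : ZMod n} (hab : a ≠ b) (hde : d ≠ e) (had : a ≠ d)
    (hae : a ≠ e) (hbd : b ≠ d) (hbe : b ≠ e) (c c' : ℂ) :
    swapHom a b c * swapHom d e c' = swapHom d e c' * swapHom a b c := by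
  apply MvPolynomial.algHom_ext
  intro j
  rw [AlgHom.mul_apply, AlgHom.mul_apply]
  by_cases hja : j = a
  · subst hja
    rw [swapHom_left, swapHom_other had hae, map_mul, swapHom_C, swapHom_left,
      swapHom_other hbd hbe]
  · by_cases hjb : j = b
    · subst hjb
      rw [swapHom_right hab, swapHom_other hbd hbe, map_mul, swapHom_C, swapHom_right hab,
        swapHom_other had hae]
    · rw [swapHom_other hja hjb]
      by_cases hjd : j = d
      · subst hjd
        rw [swapHom_left, map_mul, swapHom_C, swapHom_other hae.symm hbe.symm]
      · by_cases hje : j = e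
        · subst hje
          rw [swapHom_right hde, map_mul, swapHom_C, swapHom_other had.symm hbd.symm]
        · rw [swapHom_other hjd hje, swapHom_other hja hjb]

theorem swapHom_symm {n : ℕ} {a b : ZMod n} (hab : a ≠ b) (c : ℂ) :
    swapHom a b c = swapHom b a c⁻¹ := by
  apply MvPolynomial.algHom_ext
  intro j
  by_cases hja : j = a
  · subst hja
    rw [swapHom_left, swapHom_right hab.symm, inv_inv]
  · by_cases hjb : j = b
    · subst hjb
      rw [swapHom_left, swapHom_right hab]
    · rw [swapHom_other hja hjb, swapHom_other hjb hja]

theorem braid_pow {G : Type*} [Monoid G] {s t : G} (hs : s * s = 1) (ht : t * t = 1)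
    (h : s * t * s = t * s * t) : (s * t) ^ 3 = 1 := by
  calc (s * t) ^ 3 = s * t * s * (t * s * t) := by simp only [pow_succ, pow_zero, one_mul, mul_assoc]
    _ = s * t * s * (s * t * s) := by rw [h]
    _ = s * (t * (s * s) * t) * s := by simp only [mul_assoc]
    _ = 1 := by rw [hs, mul_one, ht, mul_one, hs]

theorem one_ne_zero_zmod {n : ℕ} (hn : 2 ≤ n) : (1 : ZMod n) ≠ 0 := by
  have : Fact (1 < n) := ⟨hn⟩
  exact one_ne_zero

theorem two_ne_zero_zmod {n : ℕ} (hn : 3 ≤ n) : (2 : ZMod n) ≠ 0 := by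
  intro h
  have h2 : ((2 : ℕ) : ZMod n) = 0 := by exact_mod_cast h
  rw [ZMod.natCast_eq_zero_iff] at h2
  exact absurd (Nat.le_of_dvd (by norm_num) h2) (by omega)

theorem self_ne_add_one {n : ℕ} (hn : 2 ≤ n) (i : ZMod n) : i ≠ i + 1 := by
  intro h
  exact one_ne_zero_zmod hn (by simpa using h.symm)

theorem self_ne_add_two {n : ℕ} (hn : 3 ≤ n) (i : ZMod n) : i ≠ i + 1 + 1 := by
  intro h
  apply two_ne_zero_zmod hn
  linear_combination -h

/-- The Coxeter matrix of affine type `Ã_{n-1}`, with vertices `ℤ/n`: neighbouring vertices of the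
`n`-cycle have entry `3` and other distinct vertices have entry `2`.  For `n = 2` the
off-diagonal entry is `∞`, which is encoded by `0`. -/
def affineCoxeterMatrix (n : ℕ) : CoxeterMatrix (ZMod n) where
  M := Matrix.of fun i j =>
    if i = j then 1 else if n = 2 then 0 else if j = i + 1 ∨ i = j + 1 then 3 else 2
  isSymm := by
    ext i j
    simp only [Matrix.transpose_apply, Matrix.of_apply, eq_comm (a := j) (b := i),
      or_comm (a := i = j + 1)]
  diagonal i := by simp
  off_diagonal i j h := by
    simp only [Matrix.of_apply, h, if_false]
    split_ifs <;> norm_num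

theorem affineCoxeterMatrix_apply (n : ℕ) (i j : ZMod n) :
    affineCoxeterMatrix n i j =
      if i = j then 1 else if n = 2 then 0 else if j = i + 1 ∨ i = j + 1 then 3 else 2 :=
  rfl

/-- The affine Weyl group `W_aff`. -/
abbrev AffineWeyl (n : ℕ) : Type := (affineCoxeterMatrix n).Group

/-- The simple reflection `s_i` of `W_aff`, for `i ∈ ℤ/n`. -/
def simpleRefl (n : ℕ) (i : ZMod n) : AffineWeyl n := (affineCoxeterMatrix n).simple i

theorem swapHom_isLiftable {n : ℕ} (hn : 2 ≤ n) {ζ : ℂ} (hζ : ζ ≠ 0) :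
    (affineCoxeterMatrix n).IsLiftable fun i : ZMod n => swapHom i (i + 1) ζ := by
  have hsq : ∀ i : ZMod n, swapHom i (i + 1) ζ * swapHom i (i + 1) ζ = 1 :=
    fun i => swapHom_mul_self (self_ne_add_one hn i) hζ
  have hbraid : ∀ i : ZMod n, 3 ≤ n →
      swapHom i (i + 1) ζ * swapHom (i + 1) (i + 1 + 1) ζ * swapHom i (i + 1) ζ =
      swapHom (i + 1) (i + 1 + 1) ζ * swapHom i (i + 1) ζ * swapHom (i + 1) (i + 1 + 1) ζ := by
    intro i h3
    have n01 := self_ne_add_one hn i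
    have n12 := self_ne_add_one hn (i + 1)
    have n02 := self_ne_add_two h3 i
    rw [swapHom_conj n12 n01 n02 hζ, swapHom_symm n12, swapHom_symm n01,
      swapHom_conj n01.symm n12.symm n02.symm (inv_ne_zero hζ), swapHom_symm n02, mul_inv]
  intro i j
  rw [affineCoxeterMatrix_apply]
  split_ifs with hij h2 hadj
  · subst hij
    rw [pow_one]
    exact hsq i
  · exact pow_zero _
  · have h3 : 3 ≤ n := by omega
    rcases hadj with rfl | rfl
    · exact braid_pow (hsq _) (hsq _) (hbraid i h3)
    · exact braid_pow (hsq _) (hsq _) (hbraid j h3).symm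
  · have n1 : j ≠ i + 1 := fun h => hadj (Or.inl h)
    have n2 : i ≠ j + 1 := fun h => hadj (Or.inr h)
    have hc := swapHom_comm (self_ne_add_one hn i) (self_ne_add_one hn j) hij n2 n1.symm
      (fun h => hij (add_right_cancel h)) ζ ζ
    change (swapHom i (i + 1) ζ * swapHom j (j + 1) ζ) ^ 2 = 1
    rw [(show Commute _ _ from hc).mul_pow, pow_two, pow_two, hsq, hsq, one_mul]

/-- The action of `W_aff` on `R_m = ℂ[x_i : i ∈ ℤ/n]` by algebra endomorphisms (composition is
the product), with `s_i(x_i) = ζ x_{i+1}`, `s_i(x_{i+1}) = ζ⁻¹ x_i`, and `s_i(x_j) = x_j` for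
`j ∉ {i, i+1}`. -/
def affineAction {n : ℕ} (hn : 2 ≤ n) {ζ : ℂ} (hζ : ζ ≠ 0) :
    AffineWeyl n →* (MvPolynomial (ZMod n) ℂ →ₐ[ℂ] MvPolynomial (ZMod n) ℂ) :=
  (affineCoxeterMatrix n).toCoxeterSystem.lift
    ⟨fun i : ZMod n => swapHom i (i + 1) ζ, swapHom_isLiftable hn hζ⟩

theorem affineAction_simpleRefl {n : ℕ} (hn : 2 ≤ n) {ζ : ℂ} (hζ : ζ ≠ 0) (i : ZMod n) :
    affineAction hn hζ (simpleRefl n i) = swapHom i (i + 1) ζ :=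
  (affineCoxeterMatrix n).toCoxeterSystem.lift_apply_simple (swapHom_isLiftable hn hζ) i

/-- The element `s_{n-1-d} ⋯ s_{n-2} s_{n-1} s_{n-2} ⋯ s_{n-1-d}` of `W_aff`. -/
def palindrome (n : ℕ) : ℕ → AffineWeyl n
  | 0 => simpleRefl n (-1)
  | d + 1 => simpleRefl n (-1 - (d + 1 : ℕ)) * palindrome n d * simpleRefl n (-1 - (d + 1 : ℕ))

/-- `t_long = s_1 s_2 ⋯ s_{n-2} s_{n-1} s_{n-2} ⋯ s_2 s_1` (for `n ≥ 2`). -/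
def longRefl (n : ℕ) : AffineWeyl n := palindrome n (n - 2)

/-- The translation `s_0 t_long` of `W_aff` by the highest root. -/
def longTranslation (n : ℕ) : AffineWeyl n := simpleRefl n 0 * longRefl n

/-- The subgroup `m Λ_rt` of `W_aff`: translations by roots are the conjugates of
`s_0 t_long`, so `m Λ_rt` is generated by the conjugates of `(s_0 t_long)^m`. -/
def scaledRootLattice (n m : ℕ) : Subgroup (AffineWeyl n) :=
  Subgroup.normalClosure {longTranslation n ^ m}

instance (n m : ℕ) : (scaledRootLattice n m).Normal :=
  inferInstanceAs (Subgroup.normalClosure {longTranslation n ^ m}).Normal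

/-- The group `W_m = W_aff / m Λ_rt`, isomorphic to the complex reflection group `G(m,m,n)`. -/
abbrev Wm (n m : ℕ) : Type := AffineWeyl n ⧸ scaledRootLattice n m

theorem neg_one_sub_ne_zero {n d : ℕ} (h : d + 2 ≤ n) : (-1 - (d : ZMod n)) ≠ 0 := by
  intro h0
  have h1 : ((d + 1 : ℕ) : ZMod n) = 0 := by
    push_cast
    linear_combination -h0
  rw [ZMod.natCast_eq_zero_iff] at h1
  exact absurd (Nat.le_of_dvd (Nat.succ_pos d) h1) (by omega)

theorem affineAction_palindrome {n : ℕ} (hn : 2 ≤ n) {ζ : ℂ} (hζ : ζ ≠ 0) (d : ℕ)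
    (hd : d + 2 ≤ n) :
    affineAction hn hζ (palindrome n d) = swapHom (-1 - (d : ZMod n)) 0 (ζ ^ (d + 1)) := by
  induction d with
  | zero => simp [palindrome, affineAction_simpleRefl]
  | succ d ih =>
    have e : (-1 - ((d + 1 : ℕ) : ZMod n)) + 1 = -1 - (d : ZMod n) := by push_cast; ring
    rw [palindrome, map_mul, map_mul, ih (by omega), affineAction_simpleRefl, e,
      swapHom_conj (neg_one_sub_ne_zero (by omega)) _ (neg_one_sub_ne_zero hd) hζ, ← pow_succ]
    rw [← e]
    exact self_ne_add_one hn _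

theorem affineAction_longRefl {n : ℕ} (hn : 2 ≤ n) {ζ : ℂ} (hζ : ζ ≠ 0) :
    affineAction hn hζ (longRefl n) = swapHom 1 0 (ζ ^ (n - 1)) := by
  rw [longRefl, affineAction_palindrome hn hζ _ (by omega)]
  have e : (-1 - ((n - 2 : ℕ) : ZMod n)) = 1 := by
    rw [Nat.cast_sub hn]; simp; ring
  rw [e, show n - 2 + 1 = n - 1 by omega]

theorem affineAction_longTranslation_pow {n m : ℕ} (hn : 2 ≤ n) {ζ : ℂ} (hζ : ζ ≠ 0)
    (h1 : ζ ^ (n * m) = 1) : affineAction hn hζ (longTranslation n ^ m) = 1 := by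
  have h10 := one_ne_zero_zmod hn
  set D := affineAction hn hζ (longTranslation n) with hD
  have hDe : D = swapHom 0 1 ζ * swapHom 1 0 (ζ ^ (n - 1)) := by
    rw [hD, longTranslation, map_mul, affineAction_longRefl, affineAction_simpleRefl, zero_add]
  have hz : ζ ^ (n - 1) * ζ = ζ ^ n := by
    rw [← pow_succ, show n - 1 + 1 = n by omega]
  have key : ∀ j : ZMod n, ∃ c : ℂ, c ^ m = 1 ∧ D (X j) = C c * X j := by
    intro j
    rw [hDe, AlgHom.mul_apply]
    by_cases hj1 : j = 1
    · subst hj1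
      refine ⟨ζ ^ n, by rw [← pow_mul, h1], ?_⟩
      rw [swapHom_left, map_mul, swapHom_C, swapHom_left, ← mul_assoc, ← C_mul, hz]
    · by_cases hj0 : j = 0
      · subst hj0
        refine ⟨(ζ ^ n)⁻¹, by rw [inv_pow, ← pow_mul, h1, inv_one], ?_⟩
        rw [swapHom_right h10, map_mul, swapHom_C, swapHom_right h10.symm, ← mul_assoc, ← C_mul,
          ← mul_inv, hz]
      · refine ⟨1, one_pow _, ?_⟩
        rw [swapHom_other hj1 hj0, swapHom_other hj0 hj1, C_1, one_mul]
  rw [map_pow]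
  apply MvPolynomial.algHom_ext
  intro j
  obtain ⟨c, hc, hj⟩ := key j
  have hpow : ∀ k : ℕ, (D ^ k) (X j) = C (c ^ k) * X j := by
    intro k
    induction k with
    | zero => simp
    | succ k ih =>
      rw [pow_succ, AlgHom.mul_apply, hj, map_mul, ih, ← algebraMap_eq, AlgHom.commutes,
        algebraMap_eq, ← mul_assoc, ← C_mul, ← pow_succ']
  rw [hpow, hc, C_1, one_mul, AlgHom.one_apply]

theorem scaledRootLattice_le_ker {n m : ℕ} (hn : 2 ≤ n) {ζ : ℂ} (hζ : ζ ≠ 0)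
    (h1 : ζ ^ (n * m) = 1) : scaledRootLattice n m ≤ (affineAction hn hζ).ker := by
  apply Subgroup.normalClosure_le_normal
  rintro _ rfl
  exact affineAction_longTranslation_pow hn hζ h1

theorem primitive_ne_zero {n m : ℕ} (hn : 2 ≤ n) (hm : 2 ≤ m) {ζ : ℂ}
    (hζ : IsPrimitiveRoot ζ (n * m)) : ζ ≠ 0 :=
  hζ.ne_zero (Nat.mul_ne_zero (by omega) (by omega))

/-- The action of `W_m` on `R_m = ℂ[x_i : i ∈ ℤ/n]` induced by the action of `W_aff`, for a
primitive `nm`-th root of unity `ζ`. -/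
def action {n m : ℕ} (hn : 2 ≤ n) (hm : 2 ≤ m) {ζ : ℂ} (hζ : IsPrimitiveRoot ζ (n * m)) :
    Wm n m →* (MvPolynomial (ZMod n) ℂ →ₐ[ℂ] MvPolynomial (ZMod n) ℂ) :=
  QuotientGroup.lift (scaledRootLattice n m) (affineAction hn (primitive_ne_zero hn hm hζ))
    (scaledRootLattice_le_ker hn (primitive_ne_zero hn hm hζ) hζ.pow_eq_one)

/-- The ring of invariants `R_m^{W_m}`, as a subalgebra of `R_m`. -/
def invariants {n m : ℕ} (hn : 2 ≤ n) (hm : 2 ≤ m) {ζ : ℂ} (hζ : IsPrimitiveRoot ζ (n * m)) :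
    Subalgebra ℂ (MvPolynomial (ZMod n) ℂ) where
  carrier := {f | ∀ w : Wm n m, action hn hm hζ w f = f}
  mul_mem' hf hg w := by rw [map_mul, hf w, hg w]
  add_mem' hf hg w := by rw [map_add, hf w, hg w]
  algebraMap_mem' r w := AlgHom.commutes _ r

/-- The exponent bounds.  The exponents are indexed here from `0`, so that `(k : ℕ) + 1`
plays the role of the index `1, …, n`.  With indices from `1` the bounds read: `a_k ≤ m (n - k)` unless `a_i = 0` for
some `i < k`, in which case `a_k ≤ m (n + 1 - k) - 1`. -/
def Admissible (n m : ℕ) (a : Fin n → ℕ) : Prop :=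
  ∀ k : Fin n,
    ((¬ ∃ i < k, a i = 0) → a k ≤ m * (n - ((k : ℕ) + 1))) ∧
    ((∃ i < k, a i = 0) → a k ≤ m * (n + 1 - ((k : ℕ) + 1)) - 1)

/-- The set `𝕏` of monomials `x_{i_1}^{a_1} ⋯ x_{i_n}^{a_n}` with admissible exponents, for the
total order `i_1 < ⋯ < i_n` on the indices that is given by the enumeration `i`. -/
def monomialSet {n : ℕ} (m : ℕ) (i : Fin n ≃ ZMod n) : Set (MvPolynomial (ZMod n) ℂ) :=
  {p | ∃ a : Fin n → ℕ, Admissible n m a ∧ p = ∏ k : Fin n, X (i k) ^ a k}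

/-- `(k)_v = 1 + v + ⋯ + v^{k-1}`. -/
def quantumNat (k : ℕ) : Polynomial ℤ := ∑ j ∈ Finset.range k, Polynomial.X ^ j

end ExoticReflection

end

/-! Number the variables `1, …, n` in the chosen order and rescale them to `y_j`, the variable times
`ζ` to the power of its index. Each `s_i` permutes the powers `T_j = y_j ^ m` and fixes the product
of all `y_j`, so the invariants contain the elementary symmetric polynomials of the `T_j` and that
product. These already suffice for spanning. Up to sign and up to invariants of positive degree
times terms of lower degree, `h_r(T_1, …, T_k)` equals `e_r(T_{k+1}, …, T_n)`. For `r = n + 1 - k`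
the latter is zero. For `r = n - k` it is `T_{k+1} ⋯ T_n`, which, times a monomial containing `y_1,
…, y_k`, is the invariant `∏ y_j` times a monomial of lower degree. So an excessive power of `y_k`
can be traded for monomials of lower degree or lexicographically smaller ones
(`monom_mem_of_reduction`, `monom_mem_span_admissible`).

Independence follows by counting. The generating function at `v = 1` gives `n! m^(n-1)` monomials,
and the group acts through at least as many distinct automorphisms. By Dedekind's independence of
characters, a spanning family no larger than a set of automorphisms fixing the scalars is
independent (`linearIndependent_of_span_of_card_le`). Neither generators of the invariant ring nor
the exact order of `W_m` are needed. -/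

noncomputable section

namespace ExoticReflection

/-! ### Generating series of complete and elementary symmetric polynomials -/

section PowerSeriesIdentities

variable {R ι : Type*} [CommRing R]

/-- The geometric power series `1 + a z + a² z² + ⋯`. -/
def geomSeries (a : R) : PowerSeries R := PowerSeries.mk fun k => a ^ k

/-- The power series `∏_{j ∈ s} (1 - T_j z)⁻¹` of complete symmetric polynomials. -/
def completeSeries (T : ι → R) (s : Finset ι) : PowerSeries R := ∏ j ∈ s, geomSeries (T j)

/-- The power series `∏_{j ∈ s} (1 - T_j z)` of signed elementary symmetric polynomials. -/
def elementarySeries (T : ι → R) (s : Finset ι) : PowerSeries R :=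
  ∏ j ∈ s, (1 - PowerSeries.C (T j) * PowerSeries.X)

theorem geomSeries_mul (a : R) : geomSeries a * (1 - PowerSeries.C a * PowerSeries.X) = 1 := by
  ext k
  rw [mul_sub, mul_one, mul_left_comm, map_sub, PowerSeries.coeff_C_mul]
  cases k with
  | zero => simp [geomSeries]
  | succ k => simp [geomSeries, PowerSeries.coeff_succ_mul_X, PowerSeries.coeff_one, pow_succ']

theorem completeSeries_mul_elementarySeries (T : ι → R) (s : Finset ι) :
    completeSeries T s * elementarySeries T s = 1 := by
  rw [completeSeries, elementarySeries, ← Finset.prod_mul_distrib]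
  exact Finset.prod_eq_one fun j _ => geomSeries_mul _

/-- The factors indexed by `s` cancel. With `s` an initial segment, the coefficient of `z ^ r` is
the relation behind the reduction. -/
theorem elementarySeries_univ_mul_completeSeries [Fintype ι] [DecidableEq ι] (T : ι → R)
    (s : Finset ι) :
    elementarySeries T Finset.univ * completeSeries T s = elementarySeries T sᶜ := by
  have h : elementarySeries T s * elementarySeries T sᶜ = elementarySeries T Finset.univ :=
    Finset.prod_mul_prod_compl s _
  rw [← h, mul_right_comm, mul_comm (elementarySeries T s), completeSeries_mul_elementarySeries,
    one_mul]

theorem coeff_zero_completeSeries (T : ι → R) (s : Finset ι) :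
    PowerSeries.coeff 0 (completeSeries T s) = 1 := by
  simp [completeSeries, geomSeries, map_prod, ← PowerSeries.coeff_zero_eq_constantCoeff_apply]

theorem coeff_zero_elementarySeries (T : ι → R) (s : Finset ι) :
    PowerSeries.coeff 0 (elementarySeries T s) = 1 := by
  simp [elementarySeries, map_prod]

/-- The vanishing and the top coefficient serve the two kinds of exponent bound, after a zero
exponent and before one. -/
theorem coeff_elementarySeries (T : ι → R) (s : Finset ι) :
    (∀ r, s.card < r → PowerSeries.coeff r (elementarySeries T s) = 0) ∧
      PowerSeries.coeff s.card (elementarySeries T s) = (-1) ^ s.card * ∏ j ∈ s, T j := by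
  classical
  induction s using Finset.induction_on with
  | empty =>
    refine ⟨fun r hr => ?_, by simp [elementarySeries]⟩
    simp only [Finset.card_empty] at hr
    simp [elementarySeries, PowerSeries.coeff_one, hr.ne']
  | insert a s ha ih =>
    have e : elementarySeries T (insert a s) =
        elementarySeries T s - PowerSeries.C (T a) * (elementarySeries T s * PowerSeries.X) := by
      rw [elementarySeries, Finset.prod_insert ha, ← elementarySeries]
      ring
    have key : ∀ r, PowerSeries.coeff (r + 1) (elementarySeries T (insert a s)) =
        PowerSeries.coeff (r + 1) (elementarySeries T s) -
          T a * PowerSeries.coeff r (elementarySeries T s) := by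
      intro r
      rw [e, map_sub, PowerSeries.coeff_C_mul, PowerSeries.coeff_succ_mul_X]
    rw [Finset.card_insert_of_notMem ha, Finset.prod_insert ha]
    refine ⟨fun r hr => ?_, ?_⟩
    · obtain ⟨r, rfl⟩ : ∃ r', r = r' + 1 := ⟨r - 1, by omega⟩
      rw [key, ih.1 _ (by omega), ih.1 _ (by omega)]
      simp
    · rw [key, ih.1 _ (by omega), ih.2]
      ring

end PowerSeriesIdentities

/-! ### Reduction of monomials to admissible ones -/

section Spanning

theorem mem_of_sum_mem {S R ι : Type*} [Ring S] [AddCommGroup R] [Module S R] (N : Submodule S R)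
    {s : Finset ι} {f : ι → R} {i : ι} (hi : i ∈ s) (hs : ∑ j ∈ s, f j ∈ N)
    (h : ∀ j ∈ s, j ≠ i → f j ∈ N) : f i ∈ N := by
  classical
  rw [← Finset.add_sum_erase s f hi] at hs
  refine (N.add_mem_iff_left (N.sum_mem fun j hj => ?_)).1 hs
  exact h j (Finset.mem_of_mem_erase hj) (Finset.ne_of_mem_erase hj)

variable {R : Type*} [CommRing R] {n : ℕ}

/-- The monomial `∏_k y_k ^ a_k`. -/
def monom (y : Fin n → R) (a : Fin n → ℕ) : R := ∏ k, y k ^ a k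

theorem monom_add (y : Fin n → R) (a b : Fin n → ℕ) :
    monom y (a + b) = monom y a * monom y b := by
  simp [monom, pow_add, Finset.prod_mul_distrib]

theorem monom_single (y : Fin n → R) (k : Fin n) (d : ℕ) :
    monom y (Pi.single k d) = y k ^ d := by
  rw [monom, Finset.prod_eq_single k]
  · simp
  · intro j _ hj
    simp [hj]
  · simp

/-- The reduction uses only the degree and the support of the monomials in `h_r`, not their
coefficients. -/
theorem coeff_completeSeries_mem_span (y : Fin n → R) (m : ℕ) (s : Finset (Fin n)) (r : ℕ) :
    PowerSeries.coeff r (completeSeries (fun j => y j ^ m) s) ∈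
      Submodule.span ℤ (monom y '' {α | (∀ j ∉ s, α j = 0) ∧ ∑ j, α j = m * r}) := by
  classical
  induction s using Finset.induction_on generalizing r with
  | empty =>
    simp only [completeSeries, Finset.prod_empty, PowerSeries.coeff_one]
    split_ifs with h
    · refine Submodule.subset_span ⟨0, ?_, by simp [monom]⟩
      simp [h]
    · exact Submodule.zero_mem _
  | insert k s hk ih =>
    rw [completeSeries, Finset.prod_insert hk, ← completeSeries, PowerSeries.coeff_mul]
    refine Submodule.sum_mem _ fun p hp => ?_
    rw [Finset.HasAntidiagonal.mem_antidiagonal] at hp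
    have h2 := ih p.2
    rw [← LinearMap.mulLeft_apply ℤ (PowerSeries.coeff p.1 _), ← Submodule.mem_comap]
    refine Submodule.span_le.2 ?_ h2
    rintro _ ⟨α, ⟨hα, hd⟩, rfl⟩
    refine Submodule.subset_span ⟨Pi.single k (m * p.1) + α, ⟨fun j hj => ?_, ?_⟩, ?_⟩
    · rw [Finset.mem_insert, not_or] at hj
      simp [hj.1, hα j hj.2]
    · simp only [Pi.add_apply, Finset.sum_add_distrib, hd, ← hp, mul_add]
      simp
    · rw [monom_add, monom_single]
      simp [geomSeries, pow_mul]

variable {K : Type*} [CommRing K] [Algebra K R] (S : Subalgebra K R)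

/-- The order on exponent vectors used for reduction: lexicographic, with the last exponent
taking precedence. -/
def ExpLT (a b : Fin n → ℕ) : Prop := Pi.Lex (· > ·) (fun {_} => (· < ·)) a b

theorem wellFounded_expLT : WellFounded (ExpLT (n := n)) :=
  Pi.Lex.wellFounded (· > ·) fun _ => wellFounded_lt

/-- One reduction step: `T_k ^ r` is the leading term of `h_r` in the variables up to `k`, and `h_r`
is traded for the symmetric polynomial `e_r` in the variables after `k`. -/
theorem monom_mem_of_reduction (y : Fin n → R) (m : ℕ) (hm : 1 ≤ m)
    (hE : ∀ r, PowerSeries.coeff r (elementarySeries (fun j => y j ^ m) Finset.univ) ∈ S)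
    (N : Submodule S R) (b : Fin n → ℕ) (k : Fin n) (r : ℕ)
    (hdeg : ∀ c : Fin n → ℕ, ∑ j, c j < ∑ j, (b + Pi.single k (m * r) : Fin n → ℕ) j → monom y c ∈ N)
    (hlex : ∀ c : Fin n → ℕ, ∑ j, c j = ∑ j, (b + Pi.single k (m * r) : Fin n → ℕ) j →
      ExpLT c (b + Pi.single k (m * r)) → monom y c ∈ N)
    (hb : monom y b * PowerSeries.coeff r (elementarySeries (fun j => y j ^ m) (Finset.Ioi k)) ∈ N) :
    monom y (b + Pi.single k (m * r)) ∈ N := by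
  classical
  set T : Fin n → R := fun j => y j ^ m with hT
  have hsum : ∀ d, ∑ j, (b + Pi.single k d : Fin n → ℕ) j = ∑ j, b j + d := by
    intro d
    simp [Finset.sum_add_distrib]
  have hspan : ∀ (s : Finset (Fin n)) (q : ℕ) (z : R),
      (∀ α : Fin n → ℕ, (∀ j ∉ s, α j = 0) → ∑ j, α j = m * q → z * monom y α ∈ N) →
      z * PowerSeries.coeff q (completeSeries T s) ∈ N := by
    intro s q z h
    have h2 := coeff_completeSeries_mem_span y m s q
    rw [← LinearMap.mulLeft_apply ℤ z, ← Submodule.restrictScalars_mem ℤ N, ← Submodule.mem_comap]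
    refine Submodule.span_le.2 ?_ h2
    rintro _ ⟨α, ⟨hα, hd⟩, rfl⟩
    exact h α hα hd
  have hc : (Finset.Iic k)ᶜ = Finset.Ioi k := by ext j; simp
  rw [← hc, ← elementarySeries_univ_mul_completeSeries, PowerSeries.coeff_mul, Finset.mul_sum] at hb
  -- A term with `i > 0` has the coefficient `E_i` in `S` and a cofactor of lower degree, so only
  -- `h_r` itself survives.
  have h1 := mem_of_sum_mem N (i := (0, r)) (by simp) hb (by
    rintro ⟨i, j⟩ hij hne
    rw [Finset.HasAntidiagonal.mem_antidiagonal] at hij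
    have hij : i + j = r := hij
    have hi : i ≠ 0 := by
      rintro rfl
      simp at hij
      simp [hij] at hne
    have : monom y b * PowerSeries.coeff j (completeSeries T (Finset.Iic k)) ∈ N := by
      apply hspan
      intro α _ hd
      rw [← monom_add]
      apply hdeg
      rw [hsum]
      simp only [Pi.add_apply, Finset.sum_add_distrib, hd]
      have : m * j < m * r := Nat.mul_lt_mul_of_pos_left (by omega) (by omega)
      omega
    have h3 := N.smul_mem ⟨_, hE i⟩ this
    rw [Subalgebra.smul_def, smul_eq_mul] at h3
    simp only
    rwa [mul_left_comm])
  simp only [coeff_zero_elementarySeries, one_mul] at h1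
  have hI : Finset.Iic k = insert k (Finset.Iio k) := by
    ext j; simp [le_iff_eq_or_lt]
  rw [hI, completeSeries, Finset.prod_insert (by simp), ← completeSeries, PowerSeries.coeff_mul,
    Finset.mul_sum] at h1
  -- Split `h_r` by the power of `T_k`. Every term except `T_k ^ r` has a smaller exponent at `k`
  -- and the same exponents after `k`.
  have h2 := mem_of_sum_mem N (i := (r, 0)) (by simp) h1 (by
    rintro ⟨i, j⟩ hij hne
    rw [Finset.HasAntidiagonal.mem_antidiagonal] at hij
    have hij : i + j = r := hij
    have hi : i < r := by
      rcases Nat.eq_zero_or_pos j with rfl | hj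
      · simp at hij
        simp [hij] at hne
      · omega
    have hmi : m * i < m * r := Nat.mul_lt_mul_of_pos_left hi (by omega)
    simp only
    rw [← mul_assoc]
    apply hspan
    intro α hα hd
    have e : monom y b * PowerSeries.coeff i (geomSeries (T k)) * monom y α =
        monom y (b + Pi.single k (m * i) + α) := by
      rw [monom_add, monom_add, monom_single]
      simp [geomSeries, hT, pow_mul]
    rw [e]
    apply hlex
    · rw [hsum]
      simp only [Pi.add_apply, Finset.sum_add_distrib, hd]
      simp only [Finset.sum_pi_single', Finset.mem_univ, if_true]
      rw [← hij]
      ring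
    · refine ⟨k, fun j hj => ?_, ?_⟩
      · have hj : k < j := hj
        simp [hj.ne', hα j (by simpa using hj.le)]
      · simp [hα k (by simp), hmi])
  rw [monom_add, monom_single]
  simpa [coeff_zero_completeSeries, geomSeries, hT, pow_mul] using h2

/-- Every monomial is a combination of admissible monomials, with coefficients in any subalgebra
that contains the elementary symmetric polynomials of the `y_j ^ m` and the product of the `y_j`. -/
theorem monom_mem_span_admissible (y : Fin n → R) (m : ℕ) (hm : 1 ≤ m)
    (hE : ∀ r, PowerSeries.coeff r (elementarySeries (fun j => y j ^ m) Finset.univ) ∈ S)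
    (hP : ∏ j, y j ∈ S) (a : Fin n → ℕ) :
    monom y a ∈ Submodule.span S (monom y '' {b | Admissible n m b}) := by
  classical
  set N := Submodule.span S (monom y '' {b | Admissible n m b}) with hN
  obtain ⟨d, hd⟩ : ∃ d, ∑ j, a j = d := ⟨_, rfl⟩
  -- The outer induction is on total degree, the inner one on `ExpLT` within a fixed degree.
  induction d using Nat.strong_induction_on generalizing a with
  | _ d ihd =>
  induction a using wellFounded_expLT.induction with
  | _ a iha =>
  by_cases ha : Admissible n m a
  · exact Submodule.subset_span ⟨a, ha, rfl⟩
  have hred : ∀ (k : Fin n) (r : ℕ), m * r ≤ a k →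
      (∀ b : Fin n → ℕ, b + Pi.single k (m * r) = a → monom y b *
        PowerSeries.coeff r (elementarySeries (fun j => y j ^ m) (Finset.Ioi k)) ∈ N) →
      monom y a ∈ N := by
    intro k r hk h
    have hba : (a - Pi.single k (m * r)) + Pi.single k (m * r) = a := by
      apply tsub_add_cancel_of_le
      intro j
      by_cases hj : j = k
      · subst hj; simpa using hk
      · simp [hj]
    have := monom_mem_of_reduction S y m hm hE N (a - Pi.single k (m * r)) k r
      (by rw [hba]; exact fun c hc => ihd _ (hd ▸ hc) c rfl)
      (by rw [hba]; exact fun c hc hlt => iha c hlt (hc.trans hd)) (h _ hba)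
    rwa [hba] at this
  rw [Admissible, not_forall] at ha
  obtain ⟨k, hk⟩ := ha
  have hcard : (Finset.Ioi k).card = n - 1 - k := by simp
  by_cases hz : ∃ i < k, a i = 0
  -- With `k` counted from `0`, only `n - 1 - k` variables come after `k`, so `e_{n-k}` of them
  -- vanishes.
  · apply hred k (n - k)
    · simp only [hz, not_true_eq_false, false_imp_iff, true_and, true_imp_iff, not_le] at hk
      have : n + 1 - ((k : ℕ) + 1) = n - k := by omega
      rw [this] at hk
      omega
    · intro b _
      rw [(coeff_elementarySeries _ _).1 _ (by rw [hcard]; omega), mul_zero]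
      exact N.zero_mem
  · have hk' : m * (n - 1 - k) < a k := by
      simp only [hz, false_imp_iff, not_false_eq_true, and_true, true_imp_iff, not_le] at hk
      rwa [show n - ((k : ℕ) + 1) = n - 1 - k by omega] at hk
    push Not at hz
    -- Now `r` is exactly the number of later variables. The strict inequality `hk'` leaves at least
    -- one factor `y_k` in `b`.
    apply hred k (n - 1 - k) hk'.le
    intro b hb
    have hb1 : ∀ j ≤ k, 1 ≤ b j := by
      intro j hj
      rcases hj.lt_or_eq with hj | rfl
      · have := hz j hj
        rw [← hb] at this
        simp [hj.ne] at this
        omega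
      · rw [← hb] at hk'
        simp at hk'
        omega
    -- The exponent of `y^b ∏_{j>k} y_j^m` after division by `∏ y_j`; its degree is that of `a`
    -- minus `n`.
    set b' : Fin n → ℕ := fun j => if k < j then b j + (m - 1) else b j - 1 with hb'
    have hb'1 : ∀ j, b' j + 1 = b j + if k < j then m else 0 := by
      intro j
      simp only [hb']
      split_ifs with h
      · omega
      · have := hb1 j (not_lt.1 h)
        omega
    have hlt : ∑ j, b' j < d := by
      have h1 : ∑ j, (b' j + 1) = ∑ j, (b j + if k < j then m else 0) :=
        Finset.sum_congr rfl fun j _ => hb'1 j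
      have h2 : ∑ j, a j = ∑ j, b j + m * (n - 1 - k) := by
        rw [← hb]
        simp [Finset.sum_add_distrib]
      have h3 : (∑ j : Fin n, if k < j then m else 0) = m * (n - 1 - k) := by
        rw [← Finset.sum_filter, Finset.sum_const, smul_eq_mul, mul_comm, ← hcard]
        congr 2
        ext j; simp
      rw [Finset.sum_add_distrib, Finset.sum_add_distrib, h3] at h1
      simp at h1
      have := k.pos
      omega
    have hmul : monom y b * ∏ j ∈ Finset.Ioi k, y j ^ m = (∏ j, y j) * monom y b' := by
      have : ∏ j ∈ Finset.Ioi k, y j ^ m = ∏ j, if k < j then y j ^ m else 1 := by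
        rw [← Finset.prod_filter]
        congr 1
        ext j; simp
      rw [this, monom, monom, ← Finset.prod_mul_distrib, ← Finset.prod_mul_distrib]
      refine Finset.prod_congr rfl fun j _ => ?_
      rw [← pow_succ', hb'1, pow_add]
      split_ifs <;> simp
    have h3 := N.smul_mem ⟨_, hP⟩ (ihd _ hlt b' rfl)
    rw [Subalgebra.smul_def, smul_eq_mul] at h3
    rw [← hcard, (coeff_elementarySeries _ _).2, mul_left_comm, hmul]
    rcases neg_one_pow_eq_or R (Finset.Ioi k).card with h | h <;> rw [h]
    · rwa [one_mul]
    · rw [neg_one_mul]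
      exact N.neg_mem h3

end Spanning

/-! ### Linear independence from enough automorphisms -/

section Independence

/-- A finite spanning family of a domain over a subalgebra is linearly independent as soon as there
are enough distinct algebra endomorphisms that fix the subalgebra. -/
theorem linearIndependent_of_span_of_card_le {K R ι κ : Type*} [CommRing K] [CommRing R]
    [IsDomain R] [Algebra K R] (S : Subalgebra K R) [Fintype ι] [Fintype κ] (v : ι → R)
    (hv : ⊤ ≤ Submodule.span S (Set.range v)) (φ : κ → (R →ₐ[K] R)) (hφ : Function.Injective φ)
    (hfix : ∀ g, ∀ s ∈ S, φ g s = s) (hcard : Fintype.card ι ≤ Fintype.card κ) :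
    LinearIndependent S v := by
  classical
  obtain ⟨f⟩ := Function.Embedding.nonempty_of_card_le hcard
  set M : Matrix ι ι R := Matrix.of fun g p => φ (f g) (v p) with hM
  -- A relation among the rows, valid on the spanning family, extends to all of `R` because each `φ
  -- g` is `S`-linear; this contradicts Dedekind's theorem.
  have hdet : M.det ≠ 0 := by
    intro h0
    obtain ⟨c, hc, hcM⟩ := Matrix.exists_vecMul_eq_zero_iff.2 h0
    have hsum : ∀ x : R, ∑ g, c g * φ (f g) x = 0 := by
      intro x
      have hx : x ∈ Submodule.span S (Set.range v) := hv trivial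
      induction hx using Submodule.span_induction with
      | mem x hx =>
        obtain ⟨p, rfl⟩ := hx
        exact congrFun hcM p
      | zero => simp
      | add x y _ _ hx hy => simp [mul_add, Finset.sum_add_distrib, hx, hy]
      | smul s x _ hx =>
        rw [Subalgebra.smul_def, smul_eq_mul]
        simp only [map_mul, hfix _ _ s.2]
        simp only [mul_left_comm _ (s : R), ← Finset.mul_sum, hx, mul_zero]
    have hind := (linearIndependent_monoidHom R R).comp
      (fun g : ι => ((φ (f g) : R →ₐ[K] R) : R →* R)) (by
        intro g g' h
        apply f.injective
        apply hφ
        ext x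
        exact DFunLike.congr_fun h x)
    rw [Fintype.linearIndependent_iff] at hind
    apply hc
    ext g
    refine hind c ?_ g
    ext x
    simpa using hsum x
  rw [Fintype.linearIndependent_iff]
  intro c hc
  -- The automorphisms fix the coefficients, so applying all of them to one relation gives a square
  -- linear system.
  have hz : M.mulVec (fun p => (c p : R)) = 0 := by
    ext g
    have := congrArg (φ (f g)) hc
    simp only [Subalgebra.smul_def, smul_eq_mul, map_sum, map_mul, hfix _ _ (c _).2, map_zero] at this
    simpa [Matrix.mulVec, dotProduct, hM, mul_comm] using this
  by_contra hne
  push Not at hne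
  obtain ⟨p, hp⟩ := hne
  refine hdet (Matrix.exists_mulVec_eq_zero_iff.1 ⟨_, fun h => hp ?_, hz⟩)
  exact Subtype.ext (congrFun h p)

end Independence

/-! ### Counting admissible exponents by degree -/

section Counting

/-- The exponent vectors bounded by `a_k ≤ m (n - k) - 1`, with `k` indexed from `0`. -/
def boxExponents (m n : ℕ) : Finset (Fin n → ℕ) :=
  Fintype.piFinset fun k => Finset.range (m * (n - k))

/-- The finite set of admissible exponent vectors, built by recursion on the first exponent. -/
def admissibleExponents (m : ℕ) : (n : ℕ) → Finset (Fin n → ℕ)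
  | 0 => Finset.univ
  | n + 1 =>
    (({0} ×ˢ boxExponents m n) ∪ (Finset.Icc 1 (m * n) ×ˢ admissibleExponents m n)).map
      (Fin.consEquiv fun _ => ℕ).toEmbedding

/-- A zero first exponent puts every later one under the second bound, a box; a positive one leaves
the same problem with `n` variables. -/
theorem admissible_cons {n m : ℕ} (hm : 1 ≤ m) (a₀ : ℕ) (a : Fin n → ℕ) :
    Admissible (n + 1) m (Fin.cons a₀ a : Fin (n + 1) → ℕ) ↔
      (a₀ = 0 ∧ a ∈ boxExponents m n) ∨ ((1 ≤ a₀ ∧ a₀ ≤ m * n) ∧ Admissible n m a) := by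
  have hex : ∀ k : Fin n, (∃ i < k.succ, (Fin.cons a₀ a : Fin (n + 1) → ℕ) i = 0) ↔
      a₀ = 0 ∨ ∃ i < k, a i = 0 := by
    intro k
    simp [Fin.exists_fin_succ, Fin.succ_lt_succ_iff]
  have e1 : ∀ k : Fin n, n + 1 - ((k : ℕ) + 1 + 1) = n - (k + 1) := fun k => by omega
  have e2 : ∀ k : Fin n, n + 1 + 1 - ((k : ℕ) + 1 + 1) = n + 1 - (k + 1) := fun k => by omega
  have e3 : ∀ k : Fin n, n + 1 - ((k : ℕ) + 1) = n - k := fun k => by omega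
  -- Positivity makes the truncated bound `≤ N - 1` equivalent to `< N`.
  have hpos : ∀ k : Fin n, 1 ≤ m * (n - k) := fun k =>
    Nat.mul_pos (by omega) (by have := k.2; omega)
  rw [Admissible, Fin.forall_fin_succ]
  simp only [hex, Fin.cons_zero, Fin.cons_succ, Fin.val_zero, Fin.val_succ, e1, e2]
  rcases Nat.eq_zero_or_pos a₀ with rfl | h0
  · simp only [boxExponents, Fintype.mem_piFinset, Finset.mem_range]
    simp only [not_lt_zero, false_and, exists_false, not_false_eq_true, zero_le, true_or,
      not_true_eq_false, false_imp_iff, true_imp_iff, true_and, and_true, e3]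
    simp only [nonpos_iff_eq_zero, one_ne_zero, false_and, or_false]
    refine forall_congr' fun k => ?_
    have := hpos k
    omega
  · have h1 : a₀ ≠ 0 := by omega
    have h2 : 1 ≤ a₀ := h0
    simp [h1, h2, Admissible]

theorem mem_admissibleExponents {n m : ℕ} (hm : 1 ≤ m) (a : Fin n → ℕ) :
    a ∈ admissibleExponents m n ↔ Admissible n m a := by
  induction n with
  | zero => simp [admissibleExponents, Admissible, eq_iff_true_of_subsingleton]
  | succ n ih =>
    obtain ⟨⟨a₀, a⟩, rfl⟩ := (Fin.consEquiv fun _ : Fin (n + 1) => ℕ).surjective a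
    rw [admissibleExponents, Finset.mem_map_equiv, Equiv.symm_apply_apply]
    change _ ↔ Admissible (n + 1) m (Fin.cons a₀ a : Fin (n + 1) → ℕ)
    rw [admissible_cons hm]
    simp [ih, and_comm, eq_comm]

theorem sum_boxExponents (m n : ℕ) :
    ∑ a ∈ boxExponents m n, (Polynomial.X : Polynomial ℤ) ^ ∑ k, a k =
      ∏ j ∈ Finset.Icc 1 n, quantumNat (j * m) := by
  have h : ∀ a : Fin n → ℕ, (Polynomial.X : Polynomial ℤ) ^ ∑ k, a k =
      ∏ k, Polynomial.X ^ a k := fun a => (Finset.prod_pow_eq_pow_sum _ _ _).symm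
  simp only [h, boxExponents]
  rw [← Finset.prod_univ_sum (fun k : Fin n => Finset.range (m * (n - k)))
    (fun _ d => (Polynomial.X : Polynomial ℤ) ^ d)]
  change ∏ k : Fin n, quantumNat (m * (n - k)) = _
  rw [Fin.prod_univ_eq_prod_range (fun k => quantumNat (m * (n - k))) n,
    ← Finset.prod_range_reflect, Finset.range_eq_Ico,
    ← Finset.Ico_add_one_right_eq_Icc, ← Finset.prod_Ico_add' _ 0 n 1]
  refine Finset.prod_congr rfl fun k hk => ?_
  rw [Finset.mem_Ico] at hk
  congr 1
  rw [mul_comm]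
  congr 1
  omega

theorem quantumNat_succ (k : ℕ) : quantumNat (k + 1) = 1 + Polynomial.X * quantumNat k := by
  rw [quantumNat, Finset.sum_range_succ', quantumNat, Finset.mul_sum, add_comm, pow_zero]
  simp only [pow_succ']

theorem sum_Icc_X_pow (k : ℕ) :
    ∑ j ∈ Finset.Icc 1 k, (Polynomial.X : Polynomial ℤ) ^ j = Polynomial.X * quantumNat k := by
  rw [quantumNat, Finset.mul_sum]
  induction k with
  | zero => simp
  | succ k ih => rw [Finset.sum_Icc_succ_top (by omega), ih, Finset.sum_range_succ, pow_succ']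

theorem sum_admissibleExponents_succ (m n : ℕ) :
    ∑ a ∈ admissibleExponents m (n + 1), (Polynomial.X : Polynomial ℤ) ^ ∑ k, a k =
      (∏ j ∈ Finset.Icc 1 n, quantumNat (j * m)) +
        Polynomial.X * quantumNat (n * m) *
          ∑ a ∈ admissibleExponents m n, (Polynomial.X : Polynomial ℤ) ^ ∑ k, a k := by
  rw [admissibleExponents, Finset.sum_map, Finset.sum_union]
  · rw [Finset.sum_product, Finset.sum_product, ← sum_boxExponents]
    congr 1
    · simp [Fin.sum_univ_succ]
    · rw [← sum_Icc_X_pow, Finset.sum_mul_sum, mul_comm n m]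
      simp [Fin.sum_univ_succ, pow_add]
  · rw [Finset.disjoint_left]
    rintro ⟨a₀, a⟩ h1 h2
    simp at h1 h2
    omega

/-- In the recursion both summands share the product of the `(jm)_v`; what remains is `1 + v (k)_v =
(k + 1)_v`. -/
theorem sum_admissibleExponents (m n : ℕ) :
    ∑ a ∈ admissibleExponents m (n + 1), (Polynomial.X : Polynomial ℤ) ^ ∑ k, a k =
      quantumNat (n + 1) * ∏ j ∈ Finset.Icc 1 n, quantumNat (j * m) := by
  induction n with
  | zero =>
    rw [sum_admissibleExponents_succ]
    simp [quantumNat]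
  | succ n ih =>
    rw [sum_admissibleExponents_succ, ih, Finset.prod_Icc_succ_top (by omega),
      quantumNat_succ (n + 1)]
    ring

theorem eval_one_quantumNat (k : ℕ) : (quantumNat k).eval 1 = k := by
  simp [quantumNat, Polynomial.eval_finsetSum]

theorem card_admissibleExponents (m n : ℕ) :
    (admissibleExponents m (n + 1)).card = (n + 1).factorial * m ^ n := by
  have h := congrArg (Polynomial.eval 1) (sum_admissibleExponents m n)
  simp only [Polynomial.eval_finsetSum, Polynomial.eval_mul, Polynomial.eval_prod,
    eval_one_quantumNat, Polynomial.eval_pow, Polynomial.eval_X, one_pow, Finset.sum_const,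
    nsmul_eq_mul, mul_one] at h
  have h2 : (admissibleExponents m (n + 1)).card = (n + 1) * ∏ j ∈ Finset.Icc 1 n, (j * m) := by
    exact_mod_cast h
  rw [h2, Finset.prod_mul_distrib, Nat.factorial_succ, ← Finset.prod_Ico_id_eq_factorial]
  simp [mul_assoc, Finset.Ico_add_one_right_eq_Icc]

end Counting

/-! ### Monomial automorphisms -/

section MonomialHoms

variable {n : ℕ}

/-- The algebra endomorphism `x_j ↦ c_j x_{σ j}`. -/
def monomialHom (σ : Equiv.Perm (ZMod n)) (c : ZMod n → ℂ) :
    MvPolynomial (ZMod n) ℂ →ₐ[ℂ] MvPolynomial (ZMod n) ℂ :=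
  aeval fun j => C (c j) * X (σ j)

theorem monomialHom_X (σ : Equiv.Perm (ZMod n)) (c : ZMod n → ℂ) (j : ZMod n) :
    monomialHom σ c (X j) = C (c j) * X (σ j) := by
  simp [monomialHom]

theorem monomialHom_mul (σ τ : Equiv.Perm (ZMod n)) (c d : ZMod n → ℂ) :
    monomialHom σ c * monomialHom τ d = monomialHom (σ * τ) (fun j => d j * c (τ j)) := by
  apply MvPolynomial.algHom_ext
  intro j
  rw [AlgHom.mul_apply, monomialHom_X, map_mul, ← algebraMap_eq, AlgHom.commutes, algebraMap_eq,
    monomialHom_X, monomialHom_X, C_mul, mul_assoc, Equiv.Perm.mul_apply]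

theorem monomialHom_one : monomialHom (1 : Equiv.Perm (ZMod n)) 1 = 1 := by
  apply MvPolynomial.algHom_ext
  intro j
  simp [monomialHom_X]

theorem monomialHom_injective {σ τ : Equiv.Perm (ZMod n)} {c d : ZMod n → ℂ}
    (hc : ∀ j, c j ≠ 0) (h : monomialHom σ c = monomialHom τ d) : σ = τ ∧ c = d := by
  have key : ∀ j, σ j = τ j ∧ c j = d j := by
    intro j
    have hj := congrArg (fun φ => φ (X j)) h
    simp only [monomialHom_X, C_mul_X_eq_monomial] at hj
    rw [monomial_eq_monomial_iff] at hj
    rcases hj with ⟨h1, h2⟩ | ⟨h1, _⟩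
    · exact ⟨Finsupp.single_left_injective one_ne_zero h1, h2⟩
    · exact absurd h1 (hc j)
  exact ⟨Equiv.ext fun j => (key j).1, funext fun j => (key j).2⟩

theorem swapHom_eq_monomialHom {a b : ZMod n} (hab : a ≠ b) (c : ℂ) :
    swapHom a b c = monomialHom (Equiv.swap a b) (Pi.mulSingle a c * Pi.mulSingle b c⁻¹) := by
  apply MvPolynomial.algHom_ext
  intro j
  rw [monomialHom_X]
  by_cases hja : j = a
  · subst hja
    simp [swapHom_left, hab]
  · by_cases hjb : j = b
    · subst hjb
      simp [swapHom_right hab, hja]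
    · simp [swapHom_other hja hjb, hja, hjb, Equiv.swap_apply_of_ne_of_ne]

theorem swapHom_mul_swapHom {a b : ZMod n} (hab : a ≠ b) (c d : ℂ) :
    swapHom a b c * swapHom b a d =
      monomialHom 1 (Pi.mulSingle a (c * d)⁻¹ * Pi.mulSingle b (c * d)) := by
  rw [swapHom_eq_monomialHom hab, swapHom_eq_monomialHom hab.symm, monomialHom_mul]
  congr 1
  · rw [Equiv.swap_comm b a, Equiv.swap_mul_self]
  · ext j
    by_cases hja : j = a
    · subst hja
      simp [hab, hab.symm, mul_comm]
    · by_cases hjb : j = b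
      · subst hjb
        simp [hja, Ne.symm hja, mul_comm]
      · simp [hja, hjb, Equiv.swap_apply_of_ne_of_ne]

end MonomialHoms

/-! ### Distinct automorphisms in the image of the group -/

section ImageOfAction

variable {n m : ℕ} (hn : 2 ≤ n) (hm : 2 ≤ m) {ζ : ℂ} (hζ : IsPrimitiveRoot ζ (n * m))

theorem action_simpleRefl (i : ZMod n) :
    action hn hm hζ (QuotientGroup.mk (simpleRefl n i)) = swapHom i (i + 1) ζ :=
  affineAction_simpleRefl hn (primitive_ne_zero hn hm hζ) i

theorem mem_invariants_of_swapHom {f : MvPolynomial (ZMod n) ℂ}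
    (h : ∀ i : ZMod n, swapHom i (i + 1) ζ f = f) : f ∈ invariants hn hm hζ := by
  intro w
  obtain ⟨w, rfl⟩ := QuotientGroup.mk_surjective w
  induction w using (affineCoxeterMatrix n).toCoxeterSystem.simple_induction with
  | simple i =>
    have := action_simpleRefl hn hm hζ i
    rw [simpleRefl] at this
    rw [CoxeterMatrix.toCoxeterSystem_simple, this, h]
  | one => rw [QuotientGroup.mk_one, map_one, AlgHom.one_apply]
  | mul w w' hw hw' => rw [QuotientGroup.mk_mul, map_mul, AlgHom.mul_apply, hw', hw]

/-- Conjugating by a neighbouring simple reflection lengthens the swap by one and contributes one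
factor `ζ`. -/
theorem swapHom_add_mem_mrange (d : ℕ) (hd : d + 1 < n) (a : ZMod n) :
    swapHom a (a + (d + 1 : ℕ)) (ζ ^ (d + 1)) ∈ MonoidHom.mrange (action hn hm hζ) := by
  induction d generalizing a with
  | zero => simpa using ⟨_, action_simpleRefl hn hm hζ a⟩
  | succ d ih =>
    have hne : ∀ (x : ZMod n) (k : ℕ), k + 1 < n → x ≠ x + (k + 1 : ℕ) := by
      intro x k hk h
      have h0 : ((k + 1 : ℕ) : ZMod n) = 0 := by simpa using h.symm
      rw [ZMod.natCast_eq_zero_iff] at h0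
      exact absurd (Nat.le_of_dvd (Nat.succ_pos k) h0) (by omega)
    have e : a + 1 + (d + 1 : ℕ) = a + (d + 1 + 1 : ℕ) := by push_cast; ring
    have h1 := ih (by omega) (a + 1)
    have h2 : swapHom a (a + 1) ζ ∈ MonoidHom.mrange (action hn hm hζ) :=
      ⟨_, action_simpleRefl hn hm hζ a⟩
    have h3 := swapHom_conj (hne (a + 1) d (by omega)) (self_ne_add_one hn a)
      (e ▸ hne a (d + 1) hd) (c := ζ ^ (d + 1)) (primitive_ne_zero hn hm hζ)
    rw [← pow_succ, e] at h3
    rw [← h3, ← e]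
    exact mul_mem (mul_mem h2 h1) h2

theorem swapHom_mem_mrange {a b : ZMod n} (hab : a ≠ b) :
    swapHom a b (ζ ^ (b - a).val) ∈ MonoidHom.mrange (action hn hm hζ) := by
  have : NeZero n := ⟨by omega⟩
  have hv : (b - a).val ≠ 0 := by
    rw [Ne, ZMod.val_eq_zero, sub_eq_zero]
    exact hab.symm
  obtain ⟨d, hd⟩ := Nat.exists_eq_succ_of_ne_zero hv
  have hlt := ZMod.val_lt (b - a)
  have h := swapHom_add_mem_mrange hn hm hζ d (by omega) a
  have e : a + ((d + 1 : ℕ) : ZMod n) = b := by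
    rw [← Nat.succ_eq_add_one, ← hd, ZMod.natCast_zmod_val]
    ring
  rwa [e, ← Nat.succ_eq_add_one, ← hd] at h

theorem exists_monomialHom_mem_mrange (σ : Equiv.Perm (ZMod n)) :
    ∃ c : ZMod n → ℂ, (∀ j, c j ≠ 0) ∧ monomialHom σ c ∈ MonoidHom.mrange (action hn hm hζ) := by
  have : NeZero n := ⟨by omega⟩
  induction σ using Equiv.Perm.swap_induction_on with
  | one => exact ⟨1, fun _ => one_ne_zero, monomialHom_one ▸ one_mem _⟩
  | swap_mul σ a b hab ih =>
    obtain ⟨c, hc, hmem⟩ := ih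
    have h := mul_mem (swapHom_mem_mrange hn hm hζ hab) hmem
    rw [swapHom_eq_monomialHom hab, monomialHom_mul] at h
    refine ⟨_, fun j => mul_ne_zero (hc j) ?_, h⟩
    have hz := pow_ne_zero (b - a).val (primitive_ne_zero hn hm hζ)
    simp only [Pi.mul_apply, Pi.mulSingle_apply]
    split_ifs <;> simp [hz]

/-- Going from `a` to `b` and back winds once around the `n`-cycle, so the two lifts of one
transposition multiply to a diagonal map with entries `(ζ ^ n)^{±1}`. -/
theorem monomialHom_mulSingle_mem_mrange {a b : ZMod n} (hab : a ≠ b) :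
    monomialHom 1 (Pi.mulSingle a (ζ ^ n) * Pi.mulSingle b (ζ ^ n)⁻¹) ∈
      MonoidHom.mrange (action hn hm hζ) := by
  have : NeZero n := ⟨by omega⟩
  have h := mul_mem (swapHom_mem_mrange hn hm hζ hab.symm) (swapHom_mem_mrange hn hm hζ hab)
  have hv : (a - b).val + (b - a).val = n := by
    rw [← neg_sub a b, ZMod.neg_val, if_neg (sub_ne_zero.2 hab)]
    have := ZMod.val_lt (a - b)
    omega
  rw [swapHom_mul_swapHom hab.symm, ← pow_add, hv, mul_comm] at h
  exact h

/-- The scalars `c` for which the diagonal automorphism `x_j ↦ c_j x_j` comes from the group. -/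
def diagonalScalars : Submonoid (ZMod n → ℂ) where
  carrier := {c | monomialHom 1 c ∈ MonoidHom.mrange (action hn hm hζ)}
  one_mem' := by
    rw [Set.mem_ofPred_eq, monomialHom_one]
    exact one_mem _
  mul_mem' {c d} hc hd := by
    rw [Set.mem_ofPred_eq] at hc hd
    have h := mul_mem hc hd
    rw [monomialHom_mul, mul_one] at h
    rw [mul_comm]
    exact h

theorem mulSingle_mem_diagonalScalars {a b : ZMod n} (hab : a ≠ b) :
    Pi.mulSingle a (ζ ^ n) * Pi.mulSingle b (ζ ^ n)⁻¹ ∈ diagonalScalars hn hm hζ :=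
  monomialHom_mulSingle_mem_mrange hn hm hζ hab

/-- The entries away from index `0` can be prescribed freely, since the entry at `0` absorbs the
inverses. -/
theorem exists_diagonalScalars (t : {j : ZMod n // j ≠ 0} → ℕ) :
    ∃ c ∈ diagonalScalars hn hm hζ, (∀ j, c j ≠ 0) ∧ ∀ j, c j.1 = (ζ ^ n) ^ t j := by
  have : NeZero n := ⟨by omega⟩
  have hz := pow_ne_zero n (primitive_ne_zero hn hm hζ)
  have hmem : ∏ j : {j : ZMod n // j ≠ 0},
      (Pi.mulSingle j.1 (ζ ^ n) * Pi.mulSingle 0 (ζ ^ n)⁻¹ : ZMod n → ℂ) ^ t j ∈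
        diagonalScalars hn hm hζ :=
    Submonoid.prod_mem _ fun j _ =>
      Submonoid.pow_mem _ (mulSingle_mem_diagonalScalars hn hm hζ j.2) _
  refine ⟨_, hmem, fun k => ?_, fun k => ?_⟩
  · rw [Finset.prod_apply]
    refine Finset.prod_ne_zero_iff.2 fun j _ => ?_
    rw [Pi.pow_apply]
    refine pow_ne_zero _ ?_
    simp only [Pi.mul_apply, Pi.mulSingle_apply]
    split_ifs <;> simp [hz]
  · rw [Finset.prod_apply, Finset.prod_eq_single k]
    · simp [k.2]
    · intro j _ hj
      have : k.1 ≠ j.1 := fun h => hj (Subtype.ext h.symm)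
      simp [this, k.2]
    · simp

/-- The action of `W_m` involves at least `n! m^(n-1)` distinct automorphisms. -/
theorem exists_injective_mrange :
    ∃ φ : Equiv.Perm (ZMod n) × ({j : ZMod n // j ≠ 0} → Fin m) →
        (MvPolynomial (ZMod n) ℂ →ₐ[ℂ] MvPolynomial (ZMod n) ℂ),
      Function.Injective φ ∧ ∀ g, φ g ∈ MonoidHom.mrange (action hn hm hζ) := by
  choose c hc hcmem using exists_monomialHom_mem_mrange hn hm hζ
  choose d hd hd0 hdt using exists_diagonalScalars hn hm hζ
  refine ⟨fun g => monomialHom g.1 (c g.1) * monomialHom 1 (d fun j => g.2 j), ?_,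
    fun g => mul_mem (hcmem _) (hd _)⟩
  rintro ⟨σ, s⟩ ⟨τ, t⟩ h
  simp only [monomialHom_mul, mul_one] at h
  obtain ⟨rfl, h2⟩ := monomialHom_injective (fun j => mul_ne_zero (hd0 _ _) (hc _ _)) h
  -- Once the permutations agree, the diagonal entries agree, and exponents below `m` are determined
  -- by powers of `ζ ^ n`.
  have hprim : IsPrimitiveRoot (ζ ^ n) m := hζ.pow (Nat.mul_pos (by omega) (by omega)) rfl
  congr 1
  ext j
  have h3 := congrFun h2 j.1
  simp only [Equiv.Perm.one_apply] at h3
  have h4 := mul_right_cancel₀ (hc _ _) h3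
  rw [hdt, hdt] at h4
  exact hprim.pow_inj (s j).2 (t j).2 h4

end ImageOfAction

/-! ### The invariants used in the reduction -/

section Invariants

variable {n m : ℕ} (hn : 2 ≤ n) (hm : 2 ≤ m) {ζ : ℂ} (hζ : IsPrimitiveRoot ζ (n * m))

theorem swapHom_rescaled_pow (hn : 2 ≤ n) (hm : 2 ≤ m) (hζ : IsPrimitiveRoot ζ (n * m))
    (a j : ZMod n) :
    swapHom a (a + 1) ζ ((C (ζ ^ j.val) * X j) ^ m) =
      (C (ζ ^ (Equiv.swap a (a + 1) j).val) * X (Equiv.swap a (a + 1) j)) ^ m := by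
  have : Fact (1 < n) := ⟨hn⟩
  have h0 := primitive_ne_zero hn hm hζ
  have hne := self_ne_add_one hn a
  -- Where `a + 1` wraps around to `0` the scalars differ by `ζ ^ n`; only the `m`-th power removes
  -- this.
  have hpow : (ζ ^ (a + 1).val) ^ m = (ζ ^ a.val * ζ) ^ m := by
    have h1 : (ζ ^ m) ^ n = 1 := by rw [← pow_mul, mul_comm m n, hζ.pow_eq_one]
    rw [← pow_succ, ← pow_mul, ← pow_mul, mul_comm _ m, mul_comm _ m, pow_mul, pow_mul,
      ZMod.val_add, ZMod.val_one, ← pow_eq_pow_mod _ h1]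
  by_cases hja : j = a
  · subst hja
    rw [Equiv.swap_apply_left, map_pow, map_mul, swapHom_C, swapHom_left, ← mul_assoc, ← C_mul,
      mul_pow, mul_pow, ← C_pow, ← C_pow, hpow]
  · by_cases hjb : j = a + 1
    · subst hjb
      rw [Equiv.swap_apply_right, map_pow, map_mul, swapHom_C, swapHom_right hne, ← mul_assoc,
        ← C_mul, mul_pow, mul_pow, ← C_pow, ← C_pow, mul_pow, hpow, ← mul_pow,
        mul_inv_cancel_right₀ h0]
    · rw [Equiv.swap_apply_of_ne_of_ne hja hjb, map_pow, map_mul, swapHom_C,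
        swapHom_other hja hjb]

theorem coeff_elementarySeries_mem_invariants (i : Fin n ≃ ZMod n) (r : ℕ) :
    PowerSeries.coeff r (elementarySeries
      (fun k => (C (ζ ^ (i k).val) * X (i k) : MvPolynomial (ZMod n) ℂ) ^ m) Finset.univ) ∈
      invariants hn hm hζ := by
  have : NeZero n := ⟨by omega⟩
  apply mem_invariants_of_swapHom
  intro a
  set φ : MvPolynomial (ZMod n) ℂ →+* MvPolynomial (ZMod n) ℂ := (swapHom a (a + 1) ζ).toRingHom
  change φ _ = _
  rw [← PowerSeries.coeff_map]
  congr 1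
  simp only [elementarySeries, map_prod, map_sub, map_one, map_mul, PowerSeries.map_C,
    PowerSeries.map_X]
  have h : ∀ j : ZMod n, φ ((C (ζ ^ j.val) * X j) ^ m) = _ :=
    fun j => swapHom_rescaled_pow hn hm hζ a j
  simp only [h]
  rw [Equiv.prod_comp i fun j => 1 - PowerSeries.C
    ((C (ζ ^ (Equiv.swap a (a + 1) j).val) * X (Equiv.swap a (a + 1) j) :
      MvPolynomial (ZMod n) ℂ) ^ m) * PowerSeries.X,
    Equiv.prod_comp i fun j => 1 - PowerSeries.C
    ((C (ζ ^ j.val) * X j : MvPolynomial (ZMod n) ℂ) ^ m) * PowerSeries.X]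
  exact Equiv.prod_comp (Equiv.swap a (a + 1)) fun j => 1 - PowerSeries.C
    ((C (ζ ^ j.val) * X j : MvPolynomial (ZMod n) ℂ) ^ m) * PowerSeries.X

/-- Each simple reflection introduces `ζ` and `ζ⁻¹` once each, so the product of the variables is
fixed. -/
theorem prod_rescaled_mem_invariants (i : Fin n ≃ ZMod n) :
    ∏ k, (C (ζ ^ (i k).val) * X (i k) : MvPolynomial (ZMod n) ℂ) ∈ invariants hn hm hζ := by
  have : NeZero n := ⟨by omega⟩
  rw [Equiv.prod_comp i fun j => (C (ζ ^ j.val) * X j : MvPolynomial (ZMod n) ℂ),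
    Finset.prod_mul_distrib]
  apply mem_invariants_of_swapHom
  intro a
  rw [map_mul, ← map_prod C, swapHom_C, swapHom_eq_monomialHom (self_ne_add_one hn a)]
  have h : monomialHom (Equiv.swap a (a + 1)) (Pi.mulSingle a ζ * Pi.mulSingle (a + 1) ζ⁻¹)
      (∏ j, X j) = ∏ j, X j := by
    rw [map_prod]
    simp only [monomialHom_X]
    rw [Finset.prod_mul_distrib, ← map_prod C,
      Equiv.prod_comp (Equiv.swap a (a + 1)) (X : ZMod n → MvPolynomial (ZMod n) ℂ)]
    simp only [Pi.mul_apply, Finset.prod_mul_distrib, Fintype.prod_pi_mulSingle']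
    rw [mul_inv_cancel₀ (primitive_ne_zero hn hm hζ), C_1, one_mul]
  rw [h]

end Invariants

/-! ### The monomial set: degrees, spanning and independence -/

section MonomialSet

variable {n m : ℕ}

theorem monom_X_comp (i : Fin n ≃ ZMod n) (s : ZMod n →₀ ℕ) :
    monom (fun k => (X (i k) : MvPolynomial (ZMod n) ℂ)) (s ∘ i) = monomial s 1 := by
  have : Fintype (ZMod n) := Fintype.ofEquiv _ i
  rw [monomial_eq, C_1, one_mul, Finsupp.prod_fintype _ _ fun _ => pow_zero _]
  exact Equiv.prod_comp i fun j => (X j : MvPolynomial (ZMod n) ℂ) ^ s j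

theorem exists_monomial_eq_monom (i : Fin n ≃ ZMod n) (a : Fin n → ℕ) :
    ∃ s : ZMod n →₀ ℕ, s ∘ i = a ∧ s.degree = ∑ k, a k := by
  have : Fintype (ZMod n) := Fintype.ofEquiv _ i
  refine ⟨Finsupp.equivFunOnFinite.symm (a ∘ i.symm), ?_, ?_⟩
  · ext k
    simp
  · rw [Finsupp.degree_eq_sum, ← Equiv.sum_comp i]
    simp

theorem monom_X_injective (i : Fin n ≃ ZMod n) :
    Function.Injective (monom fun k => (X (i k) : MvPolynomial (ZMod n) ℂ)) := by
  intro a b h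
  obtain ⟨s, rfl, -⟩ := exists_monomial_eq_monom i a
  obtain ⟨t, rfl, -⟩ := exists_monomial_eq_monom i b
  rw [monom_X_comp, monom_X_comp] at h
  rw [monomial_left_injective one_ne_zero h]

theorem isHomogeneous_monom_X (i : Fin n ≃ ZMod n) (a : Fin n → ℕ) :
    (monom (fun k => (X (i k) : MvPolynomial (ZMod n) ℂ)) a).IsHomogeneous (∑ k, a k) := by
  obtain ⟨s, rfl, hs⟩ := exists_monomial_eq_monom i a
  rw [monom_X_comp]
  exact isHomogeneous_monomial _ hs

theorem totalDegree_monom_X (i : Fin n ≃ ZMod n) (a : Fin n → ℕ) :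
    (monom (fun k => (X (i k) : MvPolynomial (ZMod n) ℂ)) a).totalDegree = ∑ k, a k := by
  refine (isHomogeneous_monom_X i a).totalDegree ?_
  obtain ⟨s, rfl, -⟩ := exists_monomial_eq_monom i a
  rw [monom_X_comp]
  simp

theorem monomialSet_eq_image (i : Fin n ≃ ZMod n) :
    monomialSet m i = monom (fun k => X (i k)) '' {a | Admissible n m a} := by
  ext p
  simp only [monomialSet, monom, Set.mem_ofPred_eq, Set.mem_image, eq_comm]

/-- The monomial set as a finite set. -/
def monomialFinset (m : ℕ) (i : Fin n ≃ ZMod n) : Finset (MvPolynomial (ZMod n) ℂ) :=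
  (admissibleExponents m n).map ⟨_, monom_X_injective i⟩

theorem coe_monomialFinset (hm : 1 ≤ m) (i : Fin n ≃ ZMod n) :
    (monomialFinset m i : Set (MvPolynomial (ZMod n) ℂ)) = monomialSet m i := by
  rw [monomialSet_eq_image, monomialFinset, Finset.coe_map]
  congr 1
  ext a
  exact mem_admissibleExponents hm a

theorem top_le_span_monomialSet (hn : 2 ≤ n) (hm : 2 ≤ m) {ζ : ℂ}
    (hζ : IsPrimitiveRoot ζ (n * m)) (i : Fin n ≃ ZMod n) :
    ⊤ ≤ Submodule.span (invariants hn hm hζ) (monomialSet m i) := by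
  set N := Submodule.span (invariants hn hm hζ) (monomialSet m i) with hN
  have hC : ∀ (c : ℂ) (p : MvPolynomial (ZMod n) ℂ), p ∈ N → C c * p ∈ N := by
    intro c p hp
    have := N.smul_mem (algebraMap ℂ (invariants hn hm hζ) c) hp
    rwa [Subalgebra.smul_def, smul_eq_mul] at this
  set y : Fin n → MvPolynomial (ZMod n) ℂ := fun k => C (ζ ^ (i k).val) * X (i k) with hy
  -- Rescaling changes a monomial only by a nonzero constant, which is an invariant, so spanning
  -- transfers from the `y_j` to the variables.
  have hscale : ∀ a : Fin n → ℕ, ∃ c : ℂ, c ≠ 0 ∧ monom y a = C c * monom (fun k => X (i k)) a := by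
    intro a
    refine ⟨∏ k, (ζ ^ (i k).val) ^ a k, Finset.prod_ne_zero_iff.2 fun k _ =>
      pow_ne_zero _ (pow_ne_zero _ (primitive_ne_zero hn hm hζ)), ?_⟩
    rw [map_prod, monom, monom, ← Finset.prod_mul_distrib]
    simp [hy, mul_pow]
  have hmon : ∀ s : ZMod n →₀ ℕ, monomial s 1 ∈ N := by
    intro s
    rw [← monom_X_comp i]
    have h := monom_mem_span_admissible (invariants hn hm hζ) y m (by omega)
      (coeff_elementarySeries_mem_invariants hn hm hζ i)
      (prod_rescaled_mem_invariants hn hm hζ i) (s ∘ i)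
    have hle : Submodule.span (invariants hn hm hζ) (monom y '' {b | Admissible n m b}) ≤ N := by
      rw [Submodule.span_le]
      rintro _ ⟨b, hb, rfl⟩
      obtain ⟨c, -, h⟩ := hscale b
      rw [h]
      refine hC _ _ (Submodule.subset_span ?_)
      rw [monomialSet_eq_image]
      exact ⟨b, hb, rfl⟩
    obtain ⟨c, hc, hs⟩ := hscale (s ∘ i)
    have h2 := hC c⁻¹ _ (hle h)
    rwa [hs, ← mul_assoc, ← C_mul, inv_mul_cancel₀ hc, C_1, one_mul] at h2
  intro p _
  rw [p.as_sum]
  refine N.sum_mem fun s _ => ?_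
  have := hC (coeff s p) _ (hmon s)
  rwa [C_mul_monomial, mul_one] at this

theorem card_admissibleExponents_of_two_le (hn : 2 ≤ n) :
    (admissibleExponents m n).card = n.factorial * m ^ (n - 1) := by
  obtain ⟨k, rfl⟩ : ∃ k, n = k + 1 := ⟨n - 1, by omega⟩
  rw [card_admissibleExponents, Nat.add_sub_cancel]

theorem linearIndependent_monomialSet (hn : 2 ≤ n) (hm : 2 ≤ m) {ζ : ℂ}
    (hζ : IsPrimitiveRoot ζ (n * m)) (i : Fin n ≃ ZMod n) :
    LinearIndependent (invariants hn hm hζ)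
      (fun p : monomialSet m i => (p : MvPolynomial (ZMod n) ℂ)) := by
  have : NeZero n := ⟨by omega⟩
  have hS := coe_monomialFinset (by omega : 1 ≤ m) i
  have : Fintype (monomialSet m i) := Fintype.ofFinset (monomialFinset m i) fun p => by
    rw [← hS, Finset.mem_coe]
  obtain ⟨φ, hφ, hmem⟩ := exists_injective_mrange hn hm hζ
  refine linearIndependent_of_span_of_card_le _ _ ?_ φ hφ ?_ ?_
  · rw [Subtype.range_coe]
    exact top_le_span_monomialSet hn hm hζ i
  · intro g s hs
    obtain ⟨w, hw⟩ := hmem g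
    rw [← hw]
    exact hs w
  · have h1 : Fintype.card (monomialSet m i) = (admissibleExponents m n).card := by
      rw [Fintype.card_of_finset' (monomialFinset m i) fun p => by rw [← hS, Finset.mem_coe],
        monomialFinset, Finset.card_map]
    rw [h1, card_admissibleExponents_of_two_le hn]
    simp [Fintype.card_perm, Fintype.card_subtype_compl]

end MonomialSet

end ExoticReflection

end

theorem mainTheorem5 (n m : ℕ) (hn : 2 ≤ n) (hm : 2 ≤ m) (ζ : ℂ)
    (hζ : IsPrimitiveRoot ζ (n * m)) (i : Fin n ≃ ZMod n) :
    (∃ b : Module.Basis (ExoticReflection.monomialSet m i)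
        (ExoticReflection.invariants hn hm hζ) (MvPolynomial (ZMod n) ℂ),
      ∀ p : ExoticReflection.monomialSet m i, b p = (p : MvPolynomial (ZMod n) ℂ)) ∧
    (∀ p ∈ ExoticReflection.monomialSet m i, p.IsHomogeneous p.totalDegree) ∧
    ∃ hfin : (ExoticReflection.monomialSet m i).Finite,
      ∑ p ∈ hfin.toFinset, (Polynomial.X : Polynomial ℤ) ^ p.totalDegree =
        ExoticReflection.quantumNat n *
          ∏ j ∈ Finset.Icc 1 (n - 1), ExoticReflection.quantumNat (j * m) := by
  have hS := ExoticReflection.coe_monomialFinset (by omega : 1 ≤ m) i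
  refine ⟨⟨Module.Basis.mk (ExoticReflection.linearIndependent_monomialSet hn hm hζ i) ?_,
    fun p => Module.Basis.mk_apply _ _ p⟩, ?_, hS ▸ Finset.finite_toSet _, ?_⟩
  · rw [Subtype.range_coe]
    exact ExoticReflection.top_le_span_monomialSet hn hm hζ i
  · intro p hp
    rw [ExoticReflection.monomialSet_eq_image] at hp
    obtain ⟨a, -, rfl⟩ := hp
    rw [ExoticReflection.totalDegree_monom_X]
    exact ExoticReflection.isHomogeneous_monom_X i a
  · have e : ∀ h : (ExoticReflection.monomialSet m i).Finite,
        h.toFinset = ExoticReflection.monomialFinset m i := by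
      intro h
      ext p
      rw [Set.Finite.mem_toFinset, ← hS, Finset.mem_coe]
    rw [e, ExoticReflection.monomialFinset, Finset.sum_map]
    simp only [Function.Embedding.coeFn_mk, ExoticReflection.totalDegree_monom_X]
    obtain ⟨k, rfl⟩ : ∃ k, n = k + 1 := ⟨n - 1, by omega⟩
    exact ExoticReflection.sum_admissibleExponents m k
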